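/- **Definitions.** An infinite real matrix $r=(r_{i,j})_{i,j\ge 1}$ is a *distance matrix* if $r_{i,i}=0$, $r_{i,j}=r_{j,i}\ge 0$ and $r_{i,j}\le r_{i,k}+r_{k,j}$ for all $i,j,k$; it is *proper* if $r_{i,j}\neq 0$ for $i\ne j$, so that $r$ is a metric on $\mathbb N$. It is *universal* if for every $\varepsilon>0$, every $n$, and every vector $a\in\mathbb R^n$ with $|a_i-a_j|\le r_{i,j}\le a_i+a_j$ for all $i,j\le n$, there is $m\in\mathbb N$ with $|r_{i,m}-a_i|<\varepsilon$ for all $i\le n$. A *Polish space* is a complete separable metric space. A *Urysohn space* is a Polish space $\mathcal U$ with the following two properties. 1) (Universality.) Every Polish space embeds isometrically in $\mathcal U$. 2) (Homogeneity.) If $a_1,\dots,a_m$ and $b_1,\dots,b_m$ are points of $\mathcal U$ with $\rho(a_i,a_j)=\rho(b_i,b_j)$ for all $i,j$, then there is an isometry $J$ of $\mathcal U$ onto itself with $J(a_i)=b_i$ for all $i$. Consider also the following property. 2′) For every finite subset $F\subset\mathcal U$ and every isometric embedding $i:F\to F'$ in a finite metric space $F'$, there is an isometric embedding $I:F'\to\mathcal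 U$ such that $I\circ i$ is the identity on $F$. **Theorem 3.** (1) If $r$ is a universal proper distance matrix, then the completion $\mathcal U_r$ of $(\mathbb N,r)$ is a Polish space with properties 1), 2) and 2′); every Urysohn space is isometric to $\mathcal U_r$, so $\mathcal U_r$ is the Urysohn space. (2) For any two universal proper distance matrices $r$ and $r'$, the completions of $(\mathbb N,r)$ and $(\mathbb N,r')$ are isometric. (3) Let $X$ be a Polish space and $(x_i)_{i\ge1}$ a sequence of points of $X$ whose terms are dense in $X$ (for instance an enumeration of a countable dense subset). Then the distance matrix $(\rho(x_i,x_j))_{i,j}$ is universal if and only if $X$ is a Urysohn space. -/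

import Mathlib

universe u v

/-- The cone `𝓡` of infinite distance matrices (rows and columns are numbered from `0`); zeros off
the main diagonal are allowed. -/
structure DistanceMatrix where
  entry : ℕ → ℕ → ℝ
  diag : ∀ i, entry i i = 0
  nonneg : ∀ i j, 0 ≤ entry i j
  symm : ∀ i j, entry i j = entry j i
  triangle : ∀ i j k, entry i j ≤ entry i k + entry k j

namespace DistanceMatrix

/-- A distance matrix is proper if it has no zeros off the main diagonal. -/
def IsProper (r : DistanceMatrix) : Prop := ∀ i j, r.entry i j = 0 → i = j

/-- The north-west corner `p_n(r)` of order `n`. -/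
def corner (r : DistanceMatrix) (n : ℕ) : Fin n → Fin n → ℝ := fun i j => r.entry i j

/-- The set `A(q)` of admissible vectors of a distance matrix `q` of order `n`: those vectors of
distances from one additional point that satisfy all triangle inequalities. -/
def admissible {n : ℕ} (q : Fin n → Fin n → ℝ) : Set (Fin n → ℝ) :=
  {a | ∀ i j, |a i - a j| ≤ q i j ∧ q i j ≤ a i + a j}

/-- Universal distance matrices. -/
def IsUniversal (r : DistanceMatrix) : Prop :=
  ∀ ε : ℝ, 0 < ε → ∀ n : ℕ, ∀ a ∈ admissible (r.corner n),
    ∃ m : ℕ, ∀ i : Fin n, |r.entry i m - a i| < ε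

/-- The set of natural numbers, to be equipped with the (semi)metric `r`. -/
def Points (_r : DistanceMatrix) : Type := ℕ

/-- The (semi)metric on the natural numbers given by `r`; it is a metric if `r` is proper. -/
instance (r : DistanceMatrix) : PseudoMetricSpace r.Points where
  dist := r.entry
  dist_self := r.diag
  dist_comm := r.symm
  dist_triangle i j k := r.triangle i k j

/-- The completion `𝓤_r` of `(ℕ, r)`, with Mathlib's metric on the completion. -/
abbrev Space (r : DistanceMatrix) : Type := UniformSpace.Completion r.Points

/-- The distance matrix of a sequence of points of a metric space. -/
def ofSeq {X : Type u} [MetricSpace X] (x : ℕ → X) : DistanceMatrix where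
  entry i j := dist (x i) (x j)
  diag _ := dist_self _
  nonneg _ _ := dist_nonneg
  symm _ _ := dist_comm _ _
  triangle _ _ _ := dist_triangle _ _ _

end DistanceMatrix

/-- Universality: every Polish (complete separable metric) space embeds isometrically in `U`. -/
def IsPolishUniversal (U : Type u) [MetricSpace U] : Prop :=
  ∀ (Y : Type v) [MetricSpace Y] [CompleteSpace Y] [TopologicalSpace.SeparableSpace Y],
    ∃ f : Y → U, Isometry f

/-- Homogeneity: for any two isometric finite subsets `A = (a_1, …, a_m)`, `B = (b_1, …, b_m)` of
`U` there is an isometry of `U` onto itself that sends `a_i` to `b_i`. -/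
def IsHomogeneousSpace (U : Type u) [MetricSpace U] : Prop :=
  ∀ (m : ℕ) (a b : Fin m → U), (∀ i j, dist (a i) (a j) = dist (b i) (b j)) →
    ∃ J : U ≃ᵢ U, ∀ i, J (a i) = b i

/-- The strong extension property: if `i` embeds a finite subset `F` of `U` isometrically in a
finite metric space `F'`, then some isometric embedding `I` of `F'` in `U` satisfies
`I ∘ i = id` on `F`. -/
def HasFiniteExtension (U : Type u) [MetricSpace U] : Prop :=
  ∀ (F : Set U), F.Finite → ∀ (F' : Type v) [MetricSpace F'] [Finite F'] (i : F → F'),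
    Isometry i → ∃ I : F' → U, Isometry I ∧ ∀ x : F, I (i x) = x

/-- Urysohn spaces: Polish spaces that are universal and homogeneous. -/
structure IsUrysohnSpace (U : Type u) [MetricSpace U] : Prop where
  complete : CompleteSpace U
  separable : TopologicalSpace.SeparableSpace U
  universal : IsPolishUniversal.{u, v} U
  homogeneous : IsHomogeneousSpace U

/-!
A distance matrix is universal iff every admissible distance vector over finitely many points of the
space is approximately realized by a point. In a complete space the approximate realizations can be
corrected successively: if `y` realizes the vector `a` over `p₁, …, pₙ` up to an error `η`, then
adding `y` to the points and `η` to the vector gives an admissible vector again, whose approximate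
realizations are much better and only about `η` away from `y`. The limit realizes `a` exactly.
Exact realizability of admissible vectors is what back-and-forth needs, and this gives universality,
homogeneity and uniqueness. Conversely, in a Urysohn space `U` the vector `a` is realized by
embedding `ℓ^∞(n)` in `U`: there `a` has distance `aᵢ` to the vector of distances from `pᵢ`, and
these vectors form an isometric copy of the `pᵢ`, which homogeneity moves to the `pᵢ`.
-/

open Filter Topology TopologicalSpace

section Admissible

/-- The numbers `a i` are admissible as distances from one additional point to the points `p i`.
For `p = id` this says that `a` is a Katětov function. -/
structure IsAdmissible {ι X : Type*} [PseudoMetricSpace X] (p : ι → X) (a : ι → ℝ) : Prop where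
  le_add_dist : ∀ i j, a i ≤ a j + dist (p i) (p j)
  dist_le : ∀ i j, dist (p i) (p j) ≤ a i + a j

/-- The vector of the distances from the point `y` to the points `p i`. -/
def distVector {ι X : Type*} [PseudoMetricSpace X] (p : ι → X) (y : X) : ι → ℝ :=
  fun i => dist (p i) y

variable {ι κ X : Type*} [PseudoMetricSpace X] {p : ι → X} {a : ι → ℝ}

theorem isAdmissible_distVector (p : ι → X) (y : X) : IsAdmissible p (distVector p y) where
  le_add_dist i j := by
    rw [add_comm]
    exact dist_triangle (p i) (p j) y
  dist_le i j := dist_triangle_right (p i) (p j) y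

theorem dist_distVector_le [Fintype ι] (p : ι → X) (y z : X) :
    dist (distVector p y) (distVector p z) ≤ dist y z :=
  (dist_pi_le_iff dist_nonneg).2 fun i => dist_dist_dist_le_right (p i) y z

theorem continuous_distVector (p : ι → X) : Continuous (distVector p) :=
  continuous_pi fun _ => continuous_const.dist continuous_id

namespace IsAdmissible

theorem nonneg (h : IsAdmissible p a) (i : ι) : 0 ≤ a i := by
  linarith [h.dist_le i i, dist_self (p i)]

theorem abs_sub_le (h : IsAdmissible p a) (i j : ι) : |a i - a j| ≤ dist (p i) (p j) := by
  rw [abs_sub_le_iff]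
  constructor <;> linarith [h.le_add_dist i j, h.le_add_dist j i, dist_comm (p i) (p j)]

theorem comp (h : IsAdmissible p a) (e : κ → ι) : IsAdmissible (p ∘ e) (a ∘ e) where
  le_add_dist i j := h.le_add_dist (e i) (e j)
  dist_le i j := h.dist_le (e i) (e j)

theorem abs_dist_sub_le_add (h : IsAdmissible p a) (y : X) (i j : ι) :
    |dist (p i) y - a i| ≤ |dist (p j) y - a j| + 2 * dist (p i) (p j) :=
  calc
    |dist (p i) y - a i| = |dist (p i) y - dist (p j) y + (dist (p j) y - a j) + (a j - a i)| := by
      congr 1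
      ring
    _ ≤ |dist (p i) y - dist (p j) y| + |dist (p j) y - a j| + |a j - a i| := abs_add_three ..
    _ ≤ dist (p i) (p j) + |dist (p j) y - a j| + dist (p j) (p i) := by
      gcongr
      · exact abs_dist_sub_le (p i) (p j) y
      · exact h.abs_sub_le j i
    _ = |dist (p j) y - a j| + 2 * dist (p i) (p j) := by
      rw [dist_comm (p j) (p i)]
      ring

theorem congr_dist {Y : Type*} [PseudoMetricSpace Y] {q : ι → Y} (h : IsAdmissible p a)
    (hpq : ∀ i j, dist (p i) (p j) = dist (q i) (q j)) : IsAdmissible q a where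
  le_add_dist i j := hpq i j ▸ h.le_add_dist i j
  dist_le i j := hpq i j ▸ h.dist_le i j

theorem dist_distVector_self [Fintype ι] (h : IsAdmissible p a) (i : ι) :
    dist (distVector p (p i)) a = a i := by
  refine le_antisymm ((dist_pi_le_iff (h.nonneg i)).2 fun j => ?_) ?_
  · rw [Real.dist_eq, abs_sub_le_iff, distVector]
    constructor <;> linarith [h.dist_le j i, h.le_add_dist i j, h.le_add_dist j i,
      dist_comm (p i) (p j)]
  · calc
      a i = dist (distVector p (p i) i) (a i) := by
        rw [distVector, dist_self, dist_zero_left, Real.norm_of_nonneg (h.nonneg i)]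
      _ ≤ dist (distVector p (p i)) a := dist_le_pi_dist _ _ i

/-- The witness is the largest such function. -/
theorem exists_katetov_extension [Nonempty ι] (h : IsAdmissible p a) :
    ∃ f : X → ℝ, IsAdmissible id f ∧ f ∘ p = a := by
  have hbdd (x : X) : BddBelow (Set.range fun i => a i + dist x (p i)) :=
    ⟨0, by rintro _ ⟨i, rfl⟩; exact add_nonneg (h.nonneg i) dist_nonneg⟩
  refine ⟨fun x => ⨅ i, (a i + dist x (p i)), ⟨fun x y => ?_, fun x y => ?_⟩, funext fun i => ?_⟩
  · rw [← sub_le_iff_le_add]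
    refine le_ciInf fun i => ?_
    have hx : ⨅ i, (a i + dist x (p i)) ≤ a i + dist x (p i) := ciInf_le (hbdd x) i
    have hxy : dist x (p i) ≤ dist (id x) (id y) + dist y (p i) := dist_triangle x y (p i)
    linarith
  · refine le_ciInf_add_ciInf fun i j => ?_
    calc
      dist x y ≤ dist x (p i) + dist y (p j) + dist (p i) (p j) := dist_triangle4_right ..
      _ ≤ a i + dist x (p i) + (a j + dist y (p j)) := by linarith [h.dist_le i j]
  · refine le_antisymm ((ciInf_le (hbdd (p i)) i).trans_eq ?_) (le_ciInf fun j => ?_)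
    · rw [dist_self, add_zero]
    · exact h.le_add_dist i j

theorem vecCons_dist_distVector {n : ℕ} {p : Fin n → X} {a : Fin n → ℝ} (h : IsAdmissible p a)
    (y : X) : IsAdmissible (Matrix.vecCons y p) (Matrix.vecCons (dist (distVector p y) a) a) := by
  set η := dist (distVector p y) a
  have hη : 0 ≤ η := dist_nonneg
  have habs (i : Fin n) : dist (p i) y ≤ a i + η ∧ a i ≤ η + dist (p i) y := by
    have := abs_sub_le_iff.1 (dist_le_pi_dist (distVector p y) a i)
    rw [distVector] at this
    constructor <;> linarith
  have hle (i : Fin n) : η ≤ dist y (p i) + a i :=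
    calc
      η ≤ dist (distVector p y) (distVector p (p i)) + dist (distVector p (p i)) a :=
        dist_triangle _ _ _
      _ ≤ dist y (p i) + a i :=
        add_le_add (dist_distVector_le p y (p i)) (h.dist_distVector_self i).le
  constructor <;> intro i j <;> cases i using Fin.cases <;> cases j using Fin.cases <;>
    simp only [Matrix.cons_val_zero, Matrix.cons_val_succ, dist_self]
  · simp
  · rw [add_comm]
    exact hle _
  · exact (habs _).2
  · exact h.le_add_dist _ _
  · linarith
  · rw [dist_comm, add_comm]
    exact (habs _).1
  · exact (habs _).1
  · exact h.dist_le _ _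

end IsAdmissible

end Admissible

section PointExtension

/-- Admissible vectors over finitely many points of `X` are realized by points of `X` up to any
error. -/
def HasApproxPointExtension (X : Type*) [PseudoMetricSpace X] : Prop :=
  ∀ (n : ℕ) (p : Fin n → X) (a : Fin n → ℝ), IsAdmissible p a →
    ∀ ε > 0, ∃ y, dist (distVector p y) a < ε

/-- Admissible vectors over finitely many points of `X` are realized exactly by points of `X`. -/
def HasPointExtension (X : Type*) [PseudoMetricSpace X] : Prop :=
  ∀ (n : ℕ) (p : Fin n → X) (a : Fin n → ℝ), IsAdmissible p a → ∃ y, distVector p y = a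

variable {X : Type*} [PseudoMetricSpace X]

theorem HasPointExtension.hasApproxPointExtension (hX : HasPointExtension X) :
    HasApproxPointExtension X := by
  intro n p a ha ε hε
  obtain ⟨y, rfl⟩ := hX n p a ha
  exact ⟨y, by rwa [dist_self]⟩

theorem HasPointExtension.exists_distVector_eq (hX : HasPointExtension X) {ι : Type*} [Finite ι]
    {p : ι → X} {a : ι → ℝ} (ha : IsAdmissible p a) : ∃ y, distVector p y = a := by
  obtain ⟨n, ⟨e⟩⟩ := Finite.exists_equiv_fin ι
  obtain ⟨y, hy⟩ := hX n _ _ (ha.comp e.symm)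
  exact ⟨y, e.symm.surjective.injective_comp_right hy⟩

theorem HasPointExtension.exists_distVector_eq_distVector (hX : HasPointExtension X)
    {ι Y : Type*} [Finite ι] [PseudoMetricSpace Y] {p : ι → X} {q : ι → Y}
    (h : ∀ i j, dist (q i) (q j) = dist (p i) (p j)) (y : Y) :
    ∃ x, distVector p x = distVector q y :=
  hX.exists_distVector_eq ((isAdmissible_distVector q y).congr_dist h)

namespace HasApproxPointExtension

theorem exists_dist_lt (hX : HasApproxPointExtension X) {n : ℕ} {p : Fin n → X} {a : Fin n → ℝ}
    (ha : IsAdmissible p a) {δ : ℝ} (hδ : 0 < δ) (y : X) :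
    ∃ z, dist (distVector p z) a < δ ∧ dist y z < dist (distVector p y) a + δ := by
  obtain ⟨z, hz⟩ := hX (n + 1) _ _ (ha.vecCons_dist_distVector y) δ hδ
  have hz' := (dist_pi_lt_iff hδ).1 hz
  refine ⟨z, (dist_pi_lt_iff hδ).2 fun i => hz' i.succ, ?_⟩
  have hyz : |dist y z - dist (distVector p y) a| < δ := hz' 0
  linarith [(abs_sub_lt_iff.1 hyz).1]

theorem hasPointExtension [CompleteSpace X] (hX : HasApproxPointExtension X) :
    HasPointExtension X := by
  intro n p a ha
  have hpos (k : ℕ) : (0 : ℝ) < (1 / 2) ^ k := by positivity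
  choose next hnext_err hnext_dist using fun k => hX.exists_dist_lt ha (hpos (k + 1))
  obtain ⟨y₀, hy₀⟩ := hX n p a ha 1 one_pos
  let u : ℕ → X := Nat.rec y₀ next
  have hu_err (k : ℕ) : dist (distVector p (u k)) a ≤ (1 / 2) ^ k := by
    cases k with
    | zero => exact hy₀.le.trans_eq (pow_zero _).symm
    | succ k => exact (hnext_err k (u k)).le
  have hu_dist (k : ℕ) : dist (u k) (u (k + 1)) ≤ 2 * (1 / 2) ^ k :=
    calc
      dist (u k) (u (k + 1)) ≤ dist (distVector p (u k)) a + (1 / 2) ^ (k + 1) :=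
        (hnext_dist k (u k)).le
      _ ≤ 2 * (1 / 2) ^ k := by
        rw [pow_succ]
        linarith [hu_err k, hpos k]
  obtain ⟨y, hy⟩ := cauchySeq_tendsto_of_complete
    (cauchySeq_of_le_geometric (1 / 2) 2 (by norm_num) hu_dist)
  have hlim_y : Tendsto (fun k => distVector p (u k)) atTop (𝓝 (distVector p y)) :=
    ((continuous_distVector p).tendsto y).comp hy
  have hlim_a : Tendsto (fun k => distVector p (u k)) atTop (𝓝 a) :=
    tendsto_iff_dist_tendsto_zero.2 <| squeeze_zero (fun _ => dist_nonneg) hu_err <|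
      tendsto_pow_atTop_nhds_zero_of_lt_one (by norm_num) (by norm_num)
  exact ⟨y, tendsto_nhds_unique hlim_y hlim_a⟩

end HasApproxPointExtension

theorem hasPointExtension_iff_hasApproxPointExtension [CompleteSpace X] :
    HasPointExtension X ↔ HasApproxPointExtension X :=
  ⟨HasPointExtension.hasApproxPointExtension, HasApproxPointExtension.hasPointExtension⟩

end PointExtension

section DenseIsometry

variable {Z X Y : Type*} [PseudoEMetricSpace Z]

theorem exists_isometry_comp_eq_of_denseRange [PseudoEMetricSpace X] [EMetricSpace Y]
    [CompleteSpace Y] {p : Z → X} {q : Z → Y} (hp : Isometry p) (hpd : DenseRange p)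
    (hq : Isometry q) : ∃ F : X → Y, Isometry F ∧ F ∘ p = q := by
  let F := (hp.isUniformInducing.isDenseInducing hpd).extend q
  have hF : Continuous F :=
    (uniformContinuous_uniformly_extend hp.isUniformInducing hpd hq.uniformContinuous).continuous
  have hFp (z : Z) : F (p z) = q z :=
    uniformly_extend_of_ind hp.isUniformInducing hpd hq.uniformContinuous z
  refine ⟨F, fun x y => ?_, funext hFp⟩
  refine hpd.induction_on₂ (p := fun x y => edist (F x) (F y) = edist x y) ?_ (fun z w => ?_) x y
  · exact isClosed_eq (by fun_prop) (by fun_prop)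
  · rw [hFp, hFp, hq, hp]

theorem exists_isometryEquiv_comp_eq_of_denseRange [EMetricSpace X] [EMetricSpace Y]
    [CompleteSpace X] [CompleteSpace Y] {p : Z → X} {q : Z → Y} (hp : Isometry p)
    (hpd : DenseRange p) (hq : Isometry q) (hqd : DenseRange q) :
    ∃ J : X ≃ᵢ Y, J ∘ p = q := by
  obtain ⟨F, hF, hFp⟩ := exists_isometry_comp_eq_of_denseRange hp hpd hq
  obtain ⟨G, hG, hGq⟩ := exists_isometry_comp_eq_of_denseRange hq hqd hp
  have hFG : F ∘ G = id := hqd.equalizer (hF.continuous.comp hG.continuous) continuous_id <| by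
    rw [Function.comp_assoc, hGq, hFp, Function.id_comp]
  exact ⟨IsometryEquiv.mk' F G (congrFun hFG) hF, hFp⟩

end DenseIsometry

section PartialIsometry

variable {X Y : Type*} [PseudoMetricSpace X] [PseudoMetricSpace Y]

/-- `G` is the graph of an isometry between a part of `X` and a part of `Y`. -/
def IsPartialIsometry (G : Set (X × Y)) : Prop :=
  ∀ a ∈ G, ∀ b ∈ G, dist a.1 b.1 = dist a.2 b.2

namespace IsPartialIsometry

variable {G : Set (X × Y)}

theorem insert (hG : IsPartialIsometry G) {x : X} {y : Y}
    (h : ∀ a ∈ G, dist a.1 x = dist a.2 y) : IsPartialIsometry (insert (x, y) G) := by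
  rintro a (rfl | ha) b (rfl | hb)
  · rw [dist_self, dist_self]
  · rw [dist_comm, h b hb, dist_comm]
  · exact h a ha
  · exact hG a ha b hb

theorem isometry_fst (hG : IsPartialIsometry G) : Isometry fun a : G => a.1.1 :=
  .of_dist_eq fun a b => by
    rw [Subtype.dist_eq, Prod.dist_eq, ← hG a a.2 b b.2, max_self]

theorem isometry_snd (hG : IsPartialIsometry G) : Isometry fun a : G => a.1.2 :=
  .of_dist_eq fun a b => by
    rw [Subtype.dist_eq, Prod.dist_eq, hG a a.2 b b.2, max_self]

end IsPartialIsometry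

/-- The isometries between finite parts of `X` and `Y`, given by their graphs and ordered by
extension: the approximations in a back-and-forth construction. -/
def FinitePartialIsometry (X Y : Type*) [PseudoMetricSpace X] [PseudoMetricSpace Y] : Type _ :=
  {G : Set (X × Y) // G.Finite ∧ IsPartialIsometry G}

namespace FinitePartialIsometry

instance : PartialOrder (FinitePartialIsometry X Y) := Subtype.partialOrder _

theorem exists_le_mem (R : FinitePartialIsometry X Y) {x : X} {y : Y}
    (h : ∀ a ∈ R.1, dist a.1 x = dist a.2 y) : ∃ S, R ≤ S ∧ (x, y) ∈ S.1 :=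
  ⟨⟨insert (x, y) R.1, R.2.1.insert _, R.2.2.insert h⟩, Set.subset_insert _ _,
    Set.mem_insert _ _⟩

/-- The cofinal set of the partial isometries that are defined at `x`. -/
def definedAt (hY : HasPointExtension Y) (x : X) :
    Order.Cofinal (FinitePartialIsometry X Y) where
  carrier := {R | x ∈ Prod.fst '' R.1}
  isCofinal R := by
    have := R.2.1.to_subtype
    obtain ⟨y, hy⟩ := hY.exists_distVector_eq_distVector
      (fun a b : R.1 => R.2.2 a a.2 b b.2) x
    obtain ⟨S, hRS, hS⟩ := R.exists_le_mem fun a ha => (congrFun hy ⟨a, ha⟩).symm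
    exact ⟨S, ⟨(x, y), hS, rfl⟩, hRS⟩

/-- The cofinal set of the partial isometries that take the value `y`. -/
def attaining (hX : HasPointExtension X) (y : Y) :
    Order.Cofinal (FinitePartialIsometry X Y) where
  carrier := {R | y ∈ Prod.snd '' R.1}
  isCofinal R := by
    have := R.2.1.to_subtype
    obtain ⟨x, hx⟩ := hX.exists_distVector_eq_distVector
      (fun a b : R.1 => (R.2.2 a a.2 b b.2).symm) y
    obtain ⟨S, hRS, hS⟩ := R.exists_le_mem fun a ha => congrFun hx ⟨a, ha⟩
    exact ⟨S, ⟨(x, y), hS, rfl⟩, hRS⟩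

theorem exists_isPartialIsometry_superset {κ : Type*} [Countable κ]
    (R : FinitePartialIsometry X Y) (D : κ → Order.Cofinal (FinitePartialIsometry X Y)) :
    ∃ G, IsPartialIsometry G ∧ R.1 ⊆ G ∧ ∀ k, ∃ S ∈ D k, S.1 ⊆ G := by
  have := Encodable.ofCountable κ
  let I := Order.idealOfCofinals R D
  refine ⟨⋃ S ∈ I, S.1, fun a ha b hb => ?_,
    Set.subset_biUnion_of_mem (Order.mem_idealOfCofinals R D), fun k => ?_⟩
  · obtain ⟨S, hS, ha⟩ := Set.mem_iUnion₂.1 ha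
    obtain ⟨T, hT, hb⟩ := Set.mem_iUnion₂.1 hb
    obtain ⟨W, -, hSW, hTW⟩ := I.directed S hS T hT
    exact W.2.2 a (hSW ha) b (hTW hb)
  · obtain ⟨S, hSD, hSI⟩ := Order.cofinal_meets_idealOfCofinals R D k
    exact ⟨S, hSD, Set.subset_biUnion_of_mem hSI⟩

/-- The partial isometry `a i ↦ b i`. -/
def ofFamily {ι : Type*} [Finite ι] (a : ι → X) (b : ι → Y)
    (h : ∀ i j, dist (a i) (a j) = dist (b i) (b j)) : FinitePartialIsometry X Y :=
  ⟨Set.range fun i => (a i, b i), Set.finite_range _, by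
    rintro _ ⟨i, rfl⟩ _ ⟨j, rfl⟩
    exact h i j⟩

end FinitePartialIsometry

end PartialIsometry

namespace IsPartialIsometry

variable {X Y : Type*} {G : Set (X × Y)}

theorem exists_isometry [PseudoMetricSpace X] [MetricSpace Y] [CompleteSpace Y]
    (hG : IsPartialIsometry G) (hX : Dense (Prod.fst '' G)) :
    ∃ F : X → Y, Isometry F ∧ ∀ a ∈ G, F a.1 = a.2 := by
  rw [Set.image_eq_range] at hX
  obtain ⟨F, hF, hFG⟩ :=
    exists_isometry_comp_eq_of_denseRange hG.isometry_fst hX hG.isometry_snd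
  exact ⟨F, hF, fun a ha => congrFun hFG ⟨a, ha⟩⟩

theorem exists_isometryEquiv [MetricSpace X] [MetricSpace Y] [CompleteSpace X] [CompleteSpace Y]
    (hG : IsPartialIsometry G) (hX : Dense (Prod.fst '' G)) (hY : Dense (Prod.snd '' G)) :
    ∃ J : X ≃ᵢ Y, ∀ a ∈ G, J a.1 = a.2 := by
  rw [Set.image_eq_range] at hX hY
  obtain ⟨J, hJ⟩ :=
    exists_isometryEquiv_comp_eq_of_denseRange hG.isometry_fst hX hG.isometry_snd hY
  exact ⟨J, fun a ha => congrFun hJ ⟨a, ha⟩⟩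

end IsPartialIsometry

namespace HasPointExtension

open FinitePartialIsometry

variable {X Y ι : Type*} [Finite ι] {a : ι → X} {b : ι → Y}

theorem exists_isometry [PseudoMetricSpace X] [SeparableSpace X] [MetricSpace Y]
    [CompleteSpace Y] (hY : HasPointExtension Y)
    (h : ∀ i j, dist (a i) (a j) = dist (b i) (b j)) :
    ∃ F : X → Y, Isometry F ∧ ∀ i, F (a i) = b i := by
  obtain ⟨s, hs, hsd⟩ := exists_countable_dense X
  have := hs.to_subtype
  obtain ⟨G, hG, hab, hsG⟩ :=
    (ofFamily a b h).exists_isPartialIsometry_superset fun x : s => definedAt hY x.1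
  have hGX : Dense (Prod.fst '' G) := hsd.mono fun x hx =>
    have ⟨_, hxS, hSG⟩ := hsG ⟨x, hx⟩
    Set.image_mono hSG hxS
  obtain ⟨F, hF, hFG⟩ := hG.exists_isometry hGX
  exact ⟨F, hF, fun i => hFG _ (hab ⟨i, rfl⟩)⟩

theorem exists_isometryEquiv [MetricSpace X] [SeparableSpace X] [CompleteSpace X]
    [MetricSpace Y] [SeparableSpace Y] [CompleteSpace Y] (hX : HasPointExtension X)
    (hY : HasPointExtension Y) (h : ∀ i j, dist (a i) (a j) = dist (b i) (b j)) :
    ∃ J : X ≃ᵢ Y, ∀ i, J (a i) = b i := by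
  obtain ⟨s, hs, hsd⟩ := exists_countable_dense X
  obtain ⟨t, ht, htd⟩ := exists_countable_dense Y
  have := hs.to_subtype
  have := ht.to_subtype
  obtain ⟨G, hG, hab, hstG⟩ := (ofFamily a b h).exists_isPartialIsometry_superset
    (Sum.elim (fun x : s => definedAt hY x.1) fun y : t => attaining hX y.1)
  have hGX : Dense (Prod.fst '' G) := hsd.mono fun x hx =>
    have ⟨_, hxS, hSG⟩ := hstG (.inl ⟨x, hx⟩)
    Set.image_mono hSG hxS
  have hGY : Dense (Prod.snd '' G) := htd.mono fun y hy =>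
    have ⟨_, hyS, hSG⟩ := hstG (.inr ⟨y, hy⟩)
    Set.image_mono hSG hyS
  obtain ⟨J, hJ⟩ := hG.exists_isometryEquiv hGX hGY
  exact ⟨J, fun i => hJ _ (hab ⟨i, rfl⟩)⟩

theorem nonempty_isometryEquiv [MetricSpace X] [SeparableSpace X] [CompleteSpace X]
    [MetricSpace Y] [SeparableSpace Y] [CompleteSpace Y] (hX : HasPointExtension X)
    (hY : HasPointExtension Y) : Nonempty (X ≃ᵢ Y) :=
  (hX.exists_isometryEquiv hY (ι := Empty) (a := Empty.elim) (b := Empty.elim) nofun).nonempty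

end HasPointExtension

section Urysohn

variable {U : Type u} [MetricSpace U]

theorem HasPointExtension.hasFiniteExtension [CompleteSpace U] (hU : HasPointExtension U) :
    HasFiniteExtension.{u, v} U := by
  intro F hF F' _ _ i hi
  have := hF.to_subtype
  exact hU.exists_isometry (a := i) (b := Subtype.val) hi.dist_eq

theorem HasPointExtension.isUrysohnSpace [CompleteSpace U] [SeparableSpace U]
    (hU : HasPointExtension U) : IsUrysohnSpace.{u, v} U where
  complete := inferInstance
  separable := inferInstance
  universal Y _ _ _ :=
    have ⟨F, hF, _⟩ :=
      hU.exists_isometry (X := Y) (ι := Empty) (a := Empty.elim) (b := Empty.elim) nofun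
    ⟨F, hF⟩
  homogeneous _ _ _ h := hU.exists_isometryEquiv hU h

theorem IsPolishUniversal.exists_isometry_fin_real (hU : IsPolishUniversal.{u, v} U) (n : ℕ) :
    ∃ φ : (Fin n → ℝ) → U, Isometry φ := by
  have : SeparableSpace (ULift.{v} (Fin n → ℝ)) :=
    Homeomorph.ulift.symm.surjective.denseRange.separableSpace Homeomorph.ulift.symm.continuous
  obtain ⟨φ, hφ⟩ := hU (ULift.{v} (Fin n → ℝ))
  exact ⟨φ ∘ ULift.up, hφ.comp fun _ _ => rfl⟩

theorem IsUrysohnSpace.hasPointExtension (hU : IsUrysohnSpace.{u, v} U) :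
    HasPointExtension U := by
  intro n p a ha
  obtain ⟨φ, hφ⟩ := hU.universal.exists_isometry_fin_real n
  obtain ⟨J, hJ⟩ := hU.homogeneous n (fun i => φ (distVector p (p i))) p fun i j => by
    rw [hφ.dist_eq, (isAdmissible_distVector p (p j)).dist_distVector_self, distVector]
  refine ⟨J (φ a), funext fun i => ?_⟩
  calc
    dist (p i) (J (φ a)) = dist (J (φ (distVector p (p i)))) (J (φ a)) := by rw [hJ]
    _ = dist (distVector p (p i)) a := by rw [J.dist_eq, hφ.dist_eq]
    _ = a i := ha.dist_distVector_self i

theorem isUrysohnSpace_iff_hasPointExtension [CompleteSpace U] [SeparableSpace U] :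
    IsUrysohnSpace.{u, v} U ↔ HasPointExtension U :=
  ⟨IsUrysohnSpace.hasPointExtension, HasPointExtension.isUrysohnSpace⟩

end Urysohn

namespace DistanceMatrix

section OfSeq

variable {X : Type*} [MetricSpace X] {x : ℕ → X}

theorem mem_admissible_corner_ofSeq {n : ℕ} {a : Fin n → ℝ} :
    a ∈ admissible ((ofSeq x).corner n) ↔ IsAdmissible (fun i : Fin n => x i) a :=
  ⟨fun h => ⟨fun i j => sub_le_iff_le_add'.1 ((le_abs_self _).trans (h i j).1),
    fun i j => (h i j).2⟩, fun h i j => ⟨h.abs_sub_le i j, h.dist_le i j⟩⟩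

theorem isUniversal_ofSeq_iff : (ofSeq x).IsUniversal ↔ ∀ ε > 0, ∀ (n : ℕ) (a : Fin n → ℝ),
    IsAdmissible (fun i : Fin n => x i) a →
      ∃ m, dist (distVector (fun i : Fin n => x i) (x m)) a < ε := by
  refine forall₄_congr fun ε hε n a => imp_congr mem_admissible_corner_ofSeq ?_
  simp only [dist_pi_lt_iff hε, Real.dist_eq, distVector, ofSeq]

theorem isUniversal_ofSeq_iff_hasApproxPointExtension (hx : DenseRange x) :
    (ofSeq x).IsUniversal ↔ HasApproxPointExtension X := by
  rw [isUniversal_ofSeq_iff]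
  refine ⟨fun h n p a ha ε hε => ?_, fun h ε hε n a ha => ?_⟩
  · rcases isEmpty_or_nonempty (Fin n) with _ | _
    · exact ⟨x 0, by rwa [Subsingleton.elim a, dist_self]⟩
    obtain ⟨f, hf, rfl⟩ := ha.exists_katetov_extension
    have hδ : 0 < ε / 3 := by positivity
    choose k hk using fun i => hx.exists_dist_lt (p i) hδ
    obtain ⟨m, hm⟩ := h (ε / 3) hδ (Finset.univ.sup k + 1) _ (hf.comp _)
    refine ⟨x m, (dist_pi_lt_iff hε).2 fun i => ?_⟩
    have hkm : |dist (x (k i)) (x m) - f (x (k i))| < ε / 3 :=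
      (dist_pi_lt_iff hδ).1 hm ⟨k i, Nat.lt_succ_of_le (Finset.le_sup (Finset.mem_univ i))⟩
    calc
      dist (distVector p (x m) i) ((f ∘ p) i)
        ≤ |dist (x (k i)) (x m) - f (x (k i))| + 2 * dist (p i) (x (k i)) :=
        hf.abs_dist_sub_le_add (x m) (p i) (x (k i))
      _ < ε := by linarith [hk i]
  · obtain ⟨y, hy⟩ := h n _ a ha (ε / 2) (half_pos hε)
    obtain ⟨m, hm⟩ := hx.exists_dist_lt y (half_pos hε)
    refine ⟨m, ?_⟩
    calc
      _ ≤ dist (distVector _ (x m)) (distVector _ y) + dist (distVector _ y) a := dist_triangle ..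
      _ ≤ dist (x m) y + dist (distVector _ y) a := by grw [dist_distVector_le]
      _ < ε / 2 + ε / 2 := add_lt_add (dist_comm (x m) y ▸ hm) hy
      _ = ε := add_halves ε

end OfSeq

/-- The canonical dense sequence of points of `r.Space`. -/
def toSpace (r : DistanceMatrix) (n : ℕ) : r.Space :=
  UniformSpace.Completion.coe' (α := r.Points) n

variable (r : DistanceMatrix)

theorem denseRange_toSpace : DenseRange r.toSpace :=
  UniformSpace.Completion.denseRange_coe (α := r.Points)

instance : SeparableSpace r.Space := .of_denseRange r.toSpace r.denseRange_toSpace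

theorem ofSeq_toSpace : ofSeq r.toSpace = r := by
  have h (i j : ℕ) : dist (r.toSpace i) (r.toSpace j) = r.entry i j :=
    UniformSpace.Completion.dist_eq (α := r.Points) i j
  cases r
  simp only [ofSeq, h]

theorem isUniversal_iff_hasPointExtension_space : r.IsUniversal ↔ HasPointExtension r.Space := by
  rw [hasPointExtension_iff_hasApproxPointExtension,
    ← isUniversal_ofSeq_iff_hasApproxPointExtension r.denseRange_toSpace, ofSeq_toSpace]

end DistanceMatrix

theorem theorem3_general :
    (∀ r : DistanceMatrix, r.IsUniversal →
      IsUrysohnSpace.{0, v} r.Space ∧ HasFiniteExtension.{0, v} r.Space ∧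
        ∀ (X : Type u) [MetricSpace X], IsUrysohnSpace.{u, v} X → Nonempty (r.Space ≃ᵢ X)) ∧
    (∀ r r' : DistanceMatrix, r.IsUniversal → r'.IsUniversal →
      Nonempty (r.Space ≃ᵢ r'.Space)) ∧
    (∀ (X : Type u) [MetricSpace X] [CompleteSpace X] (x : ℕ → X), DenseRange x →
      ((DistanceMatrix.ofSeq x).IsUniversal ↔ IsUrysohnSpace.{u, v} X)) := by
  refine ⟨fun r hr => ?_, fun r r' hr hr' => ?_, fun X _ _ x hx => ?_⟩
  · rw [DistanceMatrix.isUniversal_iff_hasPointExtension_space] at hr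
    refine ⟨hr.isUrysohnSpace, hr.hasFiniteExtension, fun X _ hX => ?_⟩
    have := hX.complete
    have := hX.separable
    exact hr.nonempty_isometryEquiv hX.hasPointExtension
  · rw [DistanceMatrix.isUniversal_iff_hasPointExtension_space] at hr hr'
    exact hr.nonempty_isometryEquiv hr'
  · have : SeparableSpace X := .of_denseRange x hx
    rw [DistanceMatrix.isUniversal_ofSeq_iff_hasApproxPointExtension hx,
      ← hasPointExtension_iff_hasApproxPointExtension, isUrysohnSpace_iff_hasPointExtension]

theorem theorem3 :
    -- `𝓤_r` is a Urysohn space, has the strong extension property, and is, up to isometry, the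
    -- only Urysohn space
    (∀ r : DistanceMatrix, r.IsProper → r.IsUniversal →
      IsUrysohnSpace.{0, v} r.Space ∧ HasFiniteExtension.{0, v} r.Space ∧
        ∀ (X : Type u) [MetricSpace X], IsUrysohnSpace.{u, v} X → Nonempty (r.Space ≃ᵢ X)) ∧
    -- uniqueness
    (∀ r r' : DistanceMatrix, r.IsProper → r.IsUniversal → r'.IsProper → r'.IsUniversal →
      Nonempty (r.Space ≃ᵢ r'.Space)) ∧
    -- universality of the distance matrix of a dense sequence characterizes the Urysohn space
    (∀ (X : Type u) [MetricSpace X] [CompleteSpace X] [TopologicalSpace.SeparableSpace X]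
      (x : ℕ → X), DenseRange x →
        ((DistanceMatrix.ofSeq x).IsUniversal ↔ IsUrysohnSpace.{u, v} X)) :=
  have ⟨hspace, huniq, hiff⟩ := theorem3_general.{u, v}
  ⟨fun r _ => hspace r, fun r r' _ hr _ => huniq r r' hr, fun X _ _ _ => hiff X⟩
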